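/- Let $\mathbb{P}_m$ be the set of $m\times m$ positive definite Hermitian complex matrices, and let $\tfrac12\le z\le 1$ and $0<\alpha\le z$. For $A,B\in\mathbb{P}_m$ put $$\Phi_{\alpha,z}(A,B)=\operatorname{tr}\big((1-\alpha)A+\alpha B\big)-\operatorname{tr}\Big(A^{\frac{1-\alpha}{2z}}B^{\frac{\alpha}{z}}A^{\frac{1-\alpha}{2z}}\Big)^{z}.$$ Let $\mathbb{A}=(A_1,\dots,A_n)\in\mathbb{P}_m^n$ and let $\omega=(w_1,\dots,w_n)$ be a probability vector with all $w_j>0$. If $\alpha<1$, then the function $X\mapsto\sum_{j=1}^n w_j\Phi_{\alpha,z}(A_j,X)$ has a unique minimizer on $\mathbb{P}_m$; it is called the $\alpha$-$z$ weighted right mean $\mathcal{R}_{\alpha,z}(\omega;\mathbb{A})$, and in the Löwner order it satisfies $$\mathcal{R}_{\alpha,z}(\omega;\mathbb{A})^{\frac{1-\alpha}{z}}\le\sum_{j=1}^n w_jA_j^{\frac{1-\alpha}{z}}.$$ In the degenerate case $\alpha=z=1$ the inequality $X^{\frac{1-\alpha}{z}}\le\sum_{j=1}^n w_jA_j^{\frac{1-\alpha}{z}}$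 holds for every minimizer $X\in\mathbb{P}_m$ (the minimizer is not unique then). -/

import Mathlib

open scoped MatrixOrder ComplexOrder

noncomputable section

/-- The matrix version of the `α`-`z` Rényi relative entropy,
`Q_{α,z}(A, B) = (A^{(1-α)/(2z)} B^{α/z} A^{(1-α)/(2z)})^z`.
Real powers are those of the continuous functional calculus. -/
def renyiQ {m : ℕ} (α z : ℝ) (A B : Matrix (Fin m) (Fin m) ℂ) : Matrix (Fin m) (Fin m) ℂ :=
  (A ^ ((1 - α) / (2 * z)) * B ^ (α / z) * A ^ ((1 - α) / (2 * z))) ^ z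

/-- The `α`-`z` Bures-Wasserstein quantum divergence
`Φ_{α,z}(A, B) = tr ((1 - α) A + α B) - tr Q_{α,z}(A, B)`.
For positive definite `A`, `B` both traces are real, so taking the real part only turns
the complex number into the real number that it is. -/
def bwDivergence {m : ℕ} (α z : ℝ) (A B : Matrix (Fin m) (Fin m) ℂ) : ℝ :=
  (((1 - α) • A + α • B).trace - (renyiQ α z A B).trace).re

/-- `X` is an `α`-`z` weighted right mean of `A₁, …, Aₙ` with weights `w₁, …, wₙ`:
`X` is positive definite and minimizes `∑ j, w j * Φ_{α,z}(A j, ·)` over all positive definite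
matrices. -/
def IsRightMean {m n : ℕ} (α z : ℝ) (w : Fin n → ℝ) (A : Fin n → Matrix (Fin m) (Fin m) ℂ)
    (X : Matrix (Fin m) (Fin m) ℂ) : Prop :=
  X.PosDef ∧ ∀ Y : Matrix (Fin m) (Fin m) ℂ, Y.PosDef →
    ∑ j, w j * bwDivergence α z (A j) X ≤ ∑ j, w j * bwDivergence α z (A j) Y

end

/-!
Put `q = z / α ≥ 1`, `T j = A j ^ ((1 - α) / (2 z))` and substitute `Y = X ^ (α / z)`. Up to a
constant, the function to be minimized is
`α tr Y ^ q - ∑ w j tr (T j Y T j) ^ z`, which is convex in `Y`, since `tr Y ^ q` is convex and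
`tr M ^ z` is concave. Both facts are used in gradient form, as instances of Klein's inequality
(`Matrix.IsHermitian.klein`), whose equality case gives strict convexity when `α < 1`, because then
`z < 1` or `q > 1`.

The gradient is `z` times `Y ^ (q - 1) - ∑ w j T j (T j Y T j) ^ (z - 1) T j`, and
`T (T Y T) ^ (z - 1) T = Y ^ (-1/2) (Y ^ (1/2) T² Y ^ (1/2)) ^ z Y ^ (-1/2)`
(`Matrix.PosDef.mul_rpow_sub_one_mul`). For `α < 1`, operator monotonicity of `t ↦ t ^ z` shows that
truncating the spectrum of `Y` to a suitable interval `[a, b]` with `a > 0` does not increase the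
function (`exists_mem_Icc_meanObjective_le`), so that a minimizer exists by compactness; it is unique
by strict convexity.

At a minimizer the gradient vanishes (`meanGradient_eq_zero`), which reads
`Y ^ q = ∑ w j (Y ^ (1/2) (T j)² Y ^ (1/2)) ^ z`. Operator convexity of `t ↦ t ^ (1 / z)`, valid as
`1 ≤ 1 / z ≤ 2`, gives `Y ^ (q / z) ≤ Y ^ (1/2) (∑ w j (T j)²) Y ^ (1/2)`, hence
`Y ^ (q / z - 1) ≤ ∑ w j (T j)²`
(`rpow_le_sum_of_meanGradient_eq_zero`). In terms of `X` and `A j` this is the claim.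
-/

section
open scoped Matrix.Norms.L2Operator
variable {n : Type*} [Fintype n] [DecidableEq n]

/-! ### Trace inequalities of Klein type -/

/-- Traces of products `g(B) f(A)` are double sums over the eigenvalues, with the nonnegative
weights `|⟨v i, u j⟩|²` for eigenbases `v` of `B` and `u` of `A`; the weights do not depend on the
functions. -/
lemma Matrix.IsHermitian.exists_trace_cfc_mul_cfc {A B : Matrix n n ℂ} (hA : A.IsHermitian)
    (hB : B.IsHermitian) : ∃ c : n → n → ℝ, (∀ i j, 0 ≤ c i j) ∧ ∀ f g : ℝ → ℝ,
      (cfc g B * cfc f A).trace.re =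
        ∑ i, ∑ j, c i j * (g (hB.eigenvalues i) * f (hA.eigenvalues j)) := by
  set U : Matrix n n ℂ := ↑hA.eigenvectorUnitary
  set V : Matrix n n ℂ := ↑hB.eigenvectorUnitary
  refine ⟨fun i j => Complex.normSq ((star V * U) i j), fun i j => Complex.normSq_nonneg _, ?_⟩
  intro f g
  have h : (cfc g B * cfc f A).trace =
      (Matrix.diagonal (fun i => (g (hB.eigenvalues i) : ℂ)) * ((star V * U) *
        Matrix.diagonal (fun i => (f (hA.eigenvalues i) : ℂ)) * star (star V * U))).trace := by
    rw [hA.cfc_eq, hB.cfc_eq, Matrix.IsHermitian.cfc, Matrix.IsHermitian.cfc,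
      Unitary.conjStarAlgAut_apply, Unitary.conjStarAlgAut_apply, star_mul, star_star,
      mul_assoc (V * _), mul_assoc V, Matrix.trace_mul_comm V]
    simp only [mul_assoc]
    rfl
  rw [h, Matrix.trace, Complex.re_sum]
  refine Finset.sum_congr rfl fun i _ => ?_
  rw [Matrix.diag_apply, Matrix.diagonal_mul, Matrix.mul_apply, Complex.re_ofReal_mul,
    Complex.re_sum, Finset.mul_sum]
  refine Finset.sum_congr rfl fun j _ => ?_
  rw [Matrix.mul_diagonal, Matrix.star_apply, mul_right_comm, Complex.star_def, Complex.mul_conj,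
    ← Complex.ofReal_mul, Complex.ofReal_re]
  ring

/-- **Klein's inequality**, with its equality case: if `f` lies above its tangents (with slope
function `g`) on a set containing both spectra, the trace of `f` does so as well, and strictness of
the scalar inequality passes to the trace inequality. -/
lemma Matrix.IsHermitian.klein {A B : Matrix n n ℂ} (hA : A.IsHermitian) (hB : B.IsHermitian)
    {f g : ℝ → ℝ} {s : Set ℝ} (hAs : ∀ i, hA.eigenvalues i ∈ s) (hBs : ∀ i, hB.eigenvalues i ∈ s)
    (hfg : ∀ x ∈ s, ∀ y ∈ s, f y + g y * (x - y) ≤ f x) :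
    (cfc f B).trace.re + (cfc g B * (A - B)).trace.re ≤ (cfc f A).trace.re ∧
      ((∀ x ∈ s, ∀ y ∈ s, x ≠ y → f y + g y * (x - y) < f x) →
        (cfc f A).trace.re ≤ (cfc f B).trace.re + (cfc g B * (A - B)).trace.re → A = B) := by
  obtain ⟨c, hc, h⟩ := hA.exists_trace_cfc_mul_cfc hB
  have cfcid (C : Matrix n n ℂ) (hC : C.IsHermitian) : cfc (fun x : ℝ => x) C = C :=
    cfc_id' ℝ C hC
  have cfcone (C : Matrix n n ℂ) (hC : C.IsHermitian) : cfc (fun _ : ℝ => (1 : ℝ)) C = 1 :=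
    cfc_const_one ℝ C hC
  have h1 : (cfc f A).trace.re = ∑ i, ∑ j, c i j * f (hA.eigenvalues j) := by
    have := h f (fun _ => 1)
    rw [cfcone B hB, one_mul] at this
    simpa using this
  have hBB (k : ℝ → ℝ) : (cfc k B).trace.re = ∑ i, ∑ j, c i j * k (hB.eigenvalues i) := by
    have := h (fun _ => 1) k
    rw [cfcone A hA, mul_one] at this
    simpa using this
  have h3 : (cfc g B * A).trace.re =
      ∑ i, ∑ j, c i j * (g (hB.eigenvalues i) * hA.eigenvalues j) := by
    have := h (fun x => x) g
    rwa [cfcid A hA] at this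
  have hfin (k : ℝ → ℝ) (C : Matrix n n ℂ) : ContinuousOn k (spectrum ℝ C) :=
    (Matrix.finite_real_spectrum).continuousOn k
  have h4 : (cfc g B * B).trace.re =
      ∑ i, ∑ j, c i j * (g (hB.eigenvalues i) * hB.eigenvalues i) := by
    have := hBB (fun x => g x * x)
    rwa [cfc_mul g (fun x => x) B (hfin _ _) (hfin _ _), cfcid B hB] at this
  have key : (cfc f A).trace.re - ((cfc f B).trace.re + (cfc g B * (A - B)).trace.re) =
      ∑ i, ∑ j, c i j * (f (hA.eigenvalues j) - (f (hB.eigenvalues i) +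
        g (hB.eigenvalues i) * (hA.eigenvalues j - hB.eigenvalues i))) := by
    rw [mul_sub, Matrix.trace_sub, Complex.sub_re, h1, hBB, h3, h4]
    simp only [← Finset.sum_sub_distrib, ← Finset.sum_add_distrib]
    refine Finset.sum_congr rfl fun i _ => Finset.sum_congr rfl fun j _ => ?_
    ring
  have hnn (i j : n) : 0 ≤ c i j * (f (hA.eigenvalues j) - (f (hB.eigenvalues i) +
        g (hB.eigenvalues i) * (hA.eigenvalues j - hB.eigenvalues i))) :=
    mul_nonneg (hc i j) (sub_nonneg.2 (hfg _ (hAs j) _ (hBs i)))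
  refine ⟨?_, fun hstrict hle => ?_⟩
  · rw [← sub_nonneg, key]
    exact Finset.sum_nonneg fun i _ => Finset.sum_nonneg fun j _ => hnn i j
  · have h0 : ∑ i, ∑ j, c i j * (f (hA.eigenvalues j) - (f (hB.eigenvalues i) +
        g (hB.eigenvalues i) * (hA.eigenvalues j - hB.eigenvalues i))) = 0 := by
      apply le_antisymm
      · rw [← key]; linarith
      · exact Finset.sum_nonneg fun i _ => Finset.sum_nonneg fun j _ => hnn i j
    -- a positive weight forces the two eigenvalues to agree
    have hzero (i j : n) : c i j * (hA.eigenvalues j - hB.eigenvalues i) ^ 2 = 0 := by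
      rw [Finset.sum_eq_zero_iff_of_nonneg fun i _ => Finset.sum_nonneg fun j _ => hnn i j] at h0
      have h0i := h0 i (Finset.mem_univ _)
      rw [Finset.sum_eq_zero_iff_of_nonneg fun j _ => hnn i j] at h0i
      rcases mul_eq_zero.1 (h0i j (Finset.mem_univ _)) with h' | h'
      · rw [h', zero_mul]
      · by_cases he : hA.eigenvalues j = hB.eigenvalues i
        · rw [he]; simp
        · have := hstrict _ (hAs j) _ (hBs i) he
          linarith
    -- hence `A - B` has Hilbert-Schmidt norm zero
    have hsq : ((A - B) * (A - B)).trace.re = 0 := by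
      have e1 : (A * A).trace.re = ∑ i, ∑ j, c i j * (hA.eigenvalues j * hA.eigenvalues j) := by
        have := h (fun x => x * x) (fun _ => 1)
        rw [cfcone B hB, one_mul, cfc_mul (fun x => x) (fun x => x) A (hfin _ _) (hfin _ _),
          cfcid A hA] at this
        simpa using this
      have e2 : (B * B).trace.re = ∑ i, ∑ j, c i j * (hB.eigenvalues i * hB.eigenvalues i) := by
        have := hBB (fun x => x * x)
        rwa [cfc_mul (fun x => x) (fun x => x) B (hfin _ _) (hfin _ _), cfcid B hB] at this
      have e3 : (B * A).trace.re = ∑ i, ∑ j, c i j * (hB.eigenvalues i * hA.eigenvalues j) := by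
        have := h (fun x => x) (fun x => x)
        rwa [cfcid A hA, cfcid B hB] at this
      have e4 : ((A - B) * (A - B)).trace.re =
          (A * A).trace.re - 2 * (B * A).trace.re + (B * B).trace.re := by
        rw [sub_mul, mul_sub, mul_sub]
        simp only [Matrix.trace_sub, Complex.sub_re]
        rw [Matrix.trace_mul_comm A B]
        ring
      rw [e4, e1, e2, e3, Finset.mul_sum, ← Finset.sum_sub_distrib, ← Finset.sum_add_distrib]
      refine Finset.sum_eq_zero fun i _ => ?_
      rw [Finset.mul_sum, ← Finset.sum_sub_distrib, ← Finset.sum_add_distrib]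
      refine Finset.sum_eq_zero fun j _ => ?_
      rw [← hzero i j]
      ring
    have hH : (A - B).IsHermitian := hA.sub hB
    have hp : 0 ≤ ((A - B).conjTranspose * (A - B)).trace :=
      (Matrix.posSemidef_conjTranspose_mul_self _).trace_nonneg
    have : ((A - B).conjTranspose * (A - B)).trace = 0 := by
      refine Complex.ext ?_ (Complex.nonneg_iff.1 hp).2.symm
      rw [hH.eq]; exact hsq
    exact sub_eq_zero.1 (Matrix.trace_conjTranspose_mul_self_eq_zero_iff.1 this)

lemma Real.tangent_lt_rpow {p x y : ℝ} (hp : 1 < p) (hx : 0 < x) (hy : 0 < y) (hxy : x ≠ y) :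
    y ^ p + p * y ^ (p - 1) * (x - y) < x ^ p := by
  have h := one_add_mul_self_lt_rpow_one_add (s := x / y - 1) (p := p)
    (by have := div_pos hx hy; linarith)
    (by rw [sub_ne_zero, ne_eq, div_eq_one_iff_eq hy.ne']; exact hxy) hp
  rw [add_sub_cancel, Real.div_rpow hx.le hy.le, lt_div_iff₀ (Real.rpow_pos_of_pos hy p)] at h
  refine lt_of_eq_of_lt ?_ h
  rw [Real.rpow_sub_one hy.ne']
  field_simp

lemma Real.rpow_lt_tangent {p x y : ℝ} (hp0 : 0 < p) (hp : p < 1) (hx : 0 < x) (hy : 0 < y)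
    (hxy : x ≠ y) : x ^ p < y ^ p + p * y ^ (p - 1) * (x - y) := by
  have h := rpow_one_add_lt_one_add_mul_self (s := x / y - 1) (p := p)
    (by have := div_pos hx hy; linarith)
    (by rw [sub_ne_zero, ne_eq, div_eq_one_iff_eq hy.ne']; exact hxy) hp0 hp
  rw [add_sub_cancel, Real.div_rpow hx.le hy.le, div_lt_iff₀ (Real.rpow_pos_of_pos hy p)] at h
  refine lt_of_lt_of_eq h ?_
  rw [Real.rpow_sub_one hy.ne']
  field_simp

namespace Matrix.PosDef

variable {A B : Matrix n n ℂ}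

lemma rpow (hA : A.PosDef) (p : ℝ) : (A ^ p).PosDef :=
  Matrix.isStrictlyPositive_iff_posDef.1 (IsStrictlyPositive.rpow A p hA.isStrictlyPositive)

omit [Fintype n] [DecidableEq n] in
lemma nonneg (hA : A.PosDef) : 0 ≤ A := hA.posSemidef.nonneg

lemma rpow_eq_cfc (hA : A.PosDef) (p : ℝ) : A ^ p = cfc (fun x : ℝ => x ^ p) A :=
  CFC.rpow_eq_cfc_real hA.nonneg

lemma const_mul_rpow_eq_cfc (hA : A.PosDef) (a p : ℝ) :
    cfc (fun x : ℝ => a * x ^ p) A = a • A ^ p := by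
  rw [hA.rpow_eq_cfc, cfc_const_mul a _ A ((Matrix.finite_real_spectrum).continuousOn _)]

/-- Convexity of `A ↦ tr A ^ p` for `p ≥ 1`, in gradient form. -/
lemma trace_rpow_ge (hA : A.PosDef) (hB : B.PosDef) {p : ℝ} (hp : 1 ≤ p) :
    (B ^ p).trace.re + p * (B ^ (p - 1) * (A - B)).trace.re ≤ (A ^ p).trace.re ∧
      (1 < p → (A ^ p).trace.re ≤ (B ^ p).trace.re + p * (B ^ (p - 1) * (A - B)).trace.re →
        A = B) := by
  have h := hA.1.klein hB.1 (f := fun x => x ^ p) (g := fun x => p * x ^ (p - 1)) (s := Set.Ioi 0)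
    hA.eigenvalues_pos hB.eigenvalues_pos (fun x hx y hy => by
      rcases eq_or_lt_of_le hp with rfl | hp
      · simp
      rcases eq_or_ne x y with rfl | hxy
      · simp
      · exact (Real.tangent_lt_rpow hp hx hy hxy).le)
  rw [← hA.rpow_eq_cfc, ← hB.rpow_eq_cfc, hB.const_mul_rpow_eq_cfc, smul_mul_assoc,
    Matrix.trace_smul, Complex.smul_re, smul_eq_mul] at h
  exact ⟨h.1, fun hp' => h.2 fun x hx y hy hxy => Real.tangent_lt_rpow hp' hx hy hxy⟩

/-- Concavity of `A ↦ tr A ^ p` for `0 < p ≤ 1`, in gradient form. -/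
lemma trace_rpow_le (hA : A.PosDef) (hB : B.PosDef) {p : ℝ} (hp0 : 0 < p) (hp : p ≤ 1) :
    (A ^ p).trace.re ≤ (B ^ p).trace.re + p * (B ^ (p - 1) * (A - B)).trace.re ∧
      (p < 1 → (B ^ p).trace.re + p * (B ^ (p - 1) * (A - B)).trace.re ≤ (A ^ p).trace.re →
        A = B) := by
  have h := hA.1.klein hB.1 (f := fun x => -1 * x ^ p) (g := fun x => (-p) * x ^ (p - 1))
    (s := Set.Ioi 0) hA.eigenvalues_pos hB.eigenvalues_pos (fun x hx y hy => by
      rcases eq_or_lt_of_le hp with rfl | hp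
      · simp
      rcases eq_or_ne x y with rfl | hxy
      · simp
      · linarith [Real.rpow_lt_tangent hp0 hp hx hy hxy])
  rw [hA.const_mul_rpow_eq_cfc, hB.const_mul_rpow_eq_cfc, hB.const_mul_rpow_eq_cfc, smul_mul_assoc,
    Matrix.trace_smul, Matrix.trace_smul, Matrix.trace_smul, Complex.smul_re, Complex.smul_re,
    Complex.smul_re, smul_eq_mul, smul_eq_mul, smul_eq_mul] at h
  refine ⟨by linarith [h.1], fun hp' hle => h.2 (fun x hx y hy hxy => ?_) (by linarith)⟩
  linarith [Real.rpow_lt_tangent hp0 hp' hx hy hxy]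

end Matrix.PosDef

/-! ### Intertwining and operator convexity of powers -/

/-- An intertwiner of two Hermitian matrices intertwines all their functions: on the two finite
spectra, every function is a polynomial. -/
lemma Matrix.IsHermitian.mul_cfc_eq_cfc_mul {M N S : Matrix n n ℂ} (hM : M.IsHermitian)
    (hN : N.IsHermitian) (h : S * M = N * S) (f : ℝ → ℝ) : S * cfc f M = cfc f N * S := by
  classical
  have hfin : (spectrum ℝ M ∪ spectrum ℝ N).Finite :=
    Matrix.finite_real_spectrum.union Matrix.finite_real_spectrum
  let P : Polynomial ℝ := Lagrange.interpolate hfin.toFinset (fun x => x) f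
  have hP (x : ℝ) (hx : x ∈ spectrum ℝ M ∪ spectrum ℝ N) : P.eval x = f x :=
    Lagrange.eval_interpolate_at_node f (v := fun x => x) (Set.injOn_id _)
      (hfin.mem_toFinset.2 hx)
  have eM : cfc f M = Polynomial.aeval M P := by
    rw [← cfc_polynomial P M hM]
    exact cfc_congr fun x hx => (hP x (Or.inl hx)).symm
  have eN : cfc f N = Polynomial.aeval N P := by
    rw [← cfc_polynomial P N hN]
    exact cfc_congr fun x hx => (hP x (Or.inr hx)).symm
  rw [eM, eN]
  induction P using Polynomial.induction_on with
  | C a => simp [Algebra.algebraMap_eq_smul_one]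
  | add p q hp hq => rw [map_add, map_add, mul_add, add_mul, hp, hq]
  | monomial k a ih =>
    rw [pow_succ, ← mul_assoc, map_mul, map_mul _ _ Polynomial.X, Polynomial.aeval_X,
      Polynomial.aeval_X, ← mul_assoc, ih, mul_assoc, h, mul_assoc]

namespace Matrix.PosDef

variable {A B T Y : Matrix n n ℂ}

lemma mul_mul_self (hT : T.PosDef) (hY : Y.PosDef) : (T * Y * T).PosDef := by
  have := hY.conjTranspose_mul_mul_same (B := T) (Matrix.mulVec_injective_of_isUnit hT.isUnit)
  rwa [hT.1.eq] at this

lemma rpow_mul_rpow (hA : A.PosDef) (p q : ℝ) : A ^ p * A ^ q = A ^ (p + q) :=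
  (CFC.rpow_add hA.isUnit).symm

lemma rpow_zero_eq (hA : A.PosDef) : A ^ (0 : ℝ) = 1 := CFC.rpow_zero A hA.nonneg

lemma rpow_one_eq (hA : A.PosDef) : A ^ (1 : ℝ) = A := CFC.rpow_one A hA.nonneg

lemma half_mul_half (hA : A.PosDef) : A ^ (1 / 2 : ℝ) * A ^ (1 / 2 : ℝ) = A := by
  rw [hA.rpow_mul_rpow, add_halves, hA.rpow_one_eq]

lemma neg_half_mul_half (hA : A.PosDef) : A ^ (-(1 / 2) : ℝ) * A ^ (1 / 2 : ℝ) = 1 := by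
  rw [hA.rpow_mul_rpow, neg_add_cancel, hA.rpow_zero_eq]

lemma half_mul_neg_half (hA : A.PosDef) : A ^ (1 / 2 : ℝ) * A ^ (-(1 / 2) : ℝ) = 1 := by
  rw [hA.rpow_mul_rpow, add_neg_cancel, hA.rpow_zero_eq]

lemma rpow_neg_one_mul (hA : A.PosDef) : A ^ (-1 : ℝ) * A = 1 := by
  nth_rw 2 [← hA.rpow_one_eq]
  rw [hA.rpow_mul_rpow, neg_add_cancel, hA.rpow_zero_eq]

lemma mul_rpow_neg_one (hA : A.PosDef) : A * A ^ (-1 : ℝ) = 1 := by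
  nth_rw 1 [← hA.rpow_one_eq]
  rw [hA.rpow_mul_rpow, add_neg_cancel, hA.rpow_zero_eq]

lemma smul_rpow (hA : A.PosDef) {k : ℝ} (hk : 0 < k) (p : ℝ) : (k • A) ^ p = k ^ p • A ^ p := by
  have hs : ∀ x ∈ spectrum ℝ A, 0 < x := fun x hx =>
    IsStrictlyPositive.spectrum_pos hA.isStrictlyPositive hx
  have h1 : k • A = cfc (fun x : ℝ => k * x) A := (cfc_const_mul_id k A hA.1).symm
  rw [h1, CFC.cfc_rpow (fun x hx => mul_pos hk (hs x hx)) (by fun_prop) hA.1,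
    ← hA.const_mul_rpow_eq_cfc]
  exact cfc_congr fun x hx => Real.mul_rpow hk.le (hs x hx).le

/-- With `S = Y ^ (1 / 2) * T`, so that `T * Y * T = Sᴴ * S`, this is `S f(SᴴS) = f(SSᴴ) S`. Both
sides are the weighted geometric mean of `T * T` and `Y⁻¹`. -/
lemma mul_rpow_sub_one_mul (hT : T.PosDef) (hY : Y.PosDef) (z : ℝ) :
    T * (T * Y * T) ^ (z - 1) * T = Y ^ (-(1 / 2) : ℝ) *
      (Y ^ (1 / 2 : ℝ) * (T * T) * Y ^ (1 / 2 : ℝ)) ^ z * Y ^ (-(1 / 2) : ℝ) := by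
  set R := Y ^ (1 / 2 : ℝ) with hR
  set R' := Y ^ (-(1 / 2) : ℝ) with hR'
  have hRR : R * R = Y := hY.half_mul_half
  have h1 : R' * R = 1 := hY.neg_half_mul_half
  have h2 : R * R' = 1 := hY.half_mul_neg_half
  have hM : (T * Y * T).PosDef := hT.mul_mul_self hY
  have hTT : (T * T).PosDef := by
    have := hT.mul_mul_self Matrix.PosDef.one
    rwa [mul_one] at this
  have hN : (R * (T * T) * R).PosDef := (hY.rpow _).mul_mul_self hTT
  have hS : (R * T) * (T * Y * T) ^ (z - 1) = (R * (T * T) * R) ^ (z - 1) * (R * T) := by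
    rw [hM.rpow_eq_cfc, hN.rpow_eq_cfc]
    refine hM.1.mul_cfc_eq_cfc_mul hN.1 ?_ _
    rw [← hRR]
    simp only [mul_assoc]
  calc T * (T * Y * T) ^ (z - 1) * T = R' * ((R * T) * (T * Y * T) ^ (z - 1)) * T := by
        rw [← mul_assoc, ← mul_assoc, h1, one_mul]
    _ = R' * ((R * (T * T) * R) ^ (z - 1) * (R * T)) * T * (R * R') := by rw [hS, h2, mul_one]
    _ = R' * ((R * (T * T) * R) ^ (z - 1) * (R * (T * T) * R)) * R' := by simp only [mul_assoc]
    _ = R' * (R * (T * T) * R) ^ z * R' := by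
        congr 2
        nth_rw 2 [← hN.rpow_one_eq]
        rw [hN.rpow_mul_rpow, sub_add_cancel]

lemma neg_half_mul_rpow_mul_neg_half (hY : Y.PosDef) (z : ℝ) :
    Y ^ (-(1 / 2) : ℝ) * Y ^ z * Y ^ (-(1 / 2) : ℝ) = Y ^ (z - 1) := by
  rw [hY.rpow_mul_rpow, hY.rpow_mul_rpow]
  congr 1
  ring

lemma mul_rpow_sub_one_mul_le (hT : T.PosDef) (hY : Y.PosDef) {z k : ℝ} (hz : z ∈ Set.Icc (0 : ℝ) 1)
    (hk : 0 < k) (hTk : T * T ≤ k • 1) :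
    T * (T * Y * T) ^ (z - 1) * T ≤ k ^ z • Y ^ (z - 1) := by
  have hR := (hY.rpow (1 / 2)).nonneg
  have hR' := (hY.rpow (-(1 / 2))).nonneg
  have h := conjugate_le_conjugate_of_nonneg hTk hR
  rw [mul_smul_comm, mul_one, smul_mul_assoc, hY.half_mul_half] at h
  have h' := conjugate_le_conjugate_of_nonneg (CFC.rpow_le_rpow hz h) hR'
  rwa [hY.smul_rpow hk, mul_smul_comm, smul_mul_assoc, hY.neg_half_mul_rpow_mul_neg_half,
    ← hT.mul_rpow_sub_one_mul hY] at h'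

lemma le_mul_rpow_sub_one_mul (hT : T.PosDef) (hY : Y.PosDef) {z k : ℝ} (hz : z ∈ Set.Icc (0 : ℝ) 1)
    (hk : 0 < k) (hTk : k • 1 ≤ T * T) :
    k ^ z • Y ^ (z - 1) ≤ T * (T * Y * T) ^ (z - 1) * T := by
  have hR := (hY.rpow (1 / 2)).nonneg
  have hR' := (hY.rpow (-(1 / 2))).nonneg
  have h := conjugate_le_conjugate_of_nonneg hTk hR
  rw [mul_smul_comm, mul_one, smul_mul_assoc, hY.half_mul_half] at h
  have h' := conjugate_le_conjugate_of_nonneg (CFC.rpow_le_rpow hz h) hR'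
  rwa [hY.smul_rpow hk, mul_smul_comm, smul_mul_assoc, hY.neg_half_mul_rpow_mul_neg_half,
    ← hT.mul_rpow_sub_one_mul hY] at h'

end Matrix.PosDef

section Sums
variable {ι : Type*} [Fintype ι] {w : ι → ℝ} {N C : ι → Matrix n n ℂ}

omit [Fintype n] [DecidableEq n] in
lemma Matrix.posDef_sum_smul (hw : ∀ j, 0 < w j) (hw1 : ∑ j, w j = 1) (hN : ∀ j, (N j).PosDef) :
    (∑ j, w j • N j).PosDef := by
  have hne : (Finset.univ : Finset ι).Nonempty := by
    rw [Finset.nonempty_iff_ne_empty]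
    intro h
    rw [h, Finset.sum_empty] at hw1
    exact zero_ne_one hw1
  exact Matrix.posDef_sum hne fun j _ => (hN j).smul (hw j)

/-- Joint convexity of `(N, C) ↦ N C⁻¹ N`. -/
lemma Matrix.PosDef.sum_smul_mul_rpow_neg_one_mul_le (hw : ∀ j, 0 < w j) (hw1 : ∑ j, w j = 1)
    (hN : ∀ j, (N j).IsHermitian) (hC : ∀ j, (C j).PosDef) :
    (∑ j, w j • N j) * (∑ j, w j • C j) ^ (-1 : ℝ) * (∑ j, w j • N j) ≤
      ∑ j, w j • (N j * (C j) ^ (-1 : ℝ) * N j) := by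
  set D := ∑ j, w j • C j with hD
  set E := ∑ j, w j • N j with hE
  have hDp : D.PosDef := Matrix.posDef_sum_smul hw hw1 hC
  have hEh : E.conjTranspose = E := by
    rw [hE, Matrix.conjTranspose_sum]
    exact Finset.sum_congr rfl fun j _ => by rw [Matrix.conjTranspose_smul, (hN j).eq, star_trivial]
  have hDh : (D ^ (-1 : ℝ)).conjTranspose = D ^ (-1 : ℝ) := (hDp.rpow _).1.eq
  -- the gap between the two sides is a weighted sum of squares centred at `C j * (D⁻¹ * E)`
  have hterm (j : ι) : star (N j - C j * (D ^ (-1 : ℝ) * E)) * C j ^ (-1 : ℝ) *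
      (N j - C j * (D ^ (-1 : ℝ) * E)) = N j * C j ^ (-1 : ℝ) * N j - N j * (D ^ (-1 : ℝ) * E) -
        E * D ^ (-1 : ℝ) * N j + E * D ^ (-1 : ℝ) * C j * (D ^ (-1 : ℝ) * E) := by
    have h1 := (hC j).mul_rpow_neg_one
    have h2 := (hC j).rpow_neg_one_mul
    rw [Matrix.star_eq_conjTranspose, Matrix.conjTranspose_sub, Matrix.conjTranspose_mul,
      Matrix.conjTranspose_mul, hDh, hEh, (hN j).eq, (hC j).1.eq, sub_mul, sub_mul, mul_sub, mul_sub,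
      mul_assoc (N j) (C j ^ (-1 : ℝ)) (C j * _), ← mul_assoc (C j ^ (-1 : ℝ)) (C j), h2, one_mul,
      mul_assoc (E * _) (C j) (C j ^ (-1 : ℝ)), h1, mul_one, ← mul_assoc _ (C j) (_ * E)]
    abel
  have hsum : ∑ j, w j • (star (N j - C j * (D ^ (-1 : ℝ) * E)) * C j ^ (-1 : ℝ) *
      (N j - C j * (D ^ (-1 : ℝ) * E))) =
      ∑ j, w j • (N j * (C j) ^ (-1 : ℝ) * N j) - E * D ^ (-1 : ℝ) * E := by
    have pull (P Q : Matrix n n ℂ) (X : ι → Matrix n n ℂ) :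
        ∑ j, w j • (P * X j * Q) = P * (∑ j, w j • X j) * Q := by
      simp only [Finset.mul_sum, Finset.sum_mul, mul_smul_comm, smul_mul_assoc]
    have e1 := pull 1 (D ^ (-1 : ℝ) * E) N
    have e2 := pull (E * D ^ (-1 : ℝ)) 1 N
    have e3 := pull (E * D ^ (-1 : ℝ)) (D ^ (-1 : ℝ) * E) C
    simp only [one_mul, mul_one] at e1 e2
    simp only [hterm, smul_add, smul_sub, Finset.sum_add_distrib, Finset.sum_sub_distrib]
    rw [e1, e2, e3, ← hE, ← hD, mul_assoc E _ D, hDp.rpow_neg_one_mul, mul_one, ← mul_assoc E]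
    abel
  rw [← sub_nonneg, ← hsum]
  exact Finset.sum_nonneg fun j _ =>
    smul_nonneg (hw j).le (star_left_conjugate_nonneg ((hC j).rpow _).nonneg _)

/-- Operator Jensen inequality for the operator convex function `t ↦ t ^ q`, `1 ≤ q ≤ 2`. It
follows from `N ^ q = N (N ^ (2 - q))⁻¹ N`, the operator concavity of `t ↦ t ^ (2 - q)` and the
joint convexity of `(N, C) ↦ N C⁻¹ N`. -/
lemma Matrix.PosDef.sum_smul_rpow_le (hw : ∀ j, 0 < w j) (hw1 : ∑ j, w j = 1)
    (hN : ∀ j, (N j).PosDef) {q : ℝ} (hq1 : 1 ≤ q) (hq2 : q ≤ 2) :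
    (∑ j, w j • N j) ^ q ≤ ∑ j, w j • N j ^ q := by
  have hE : (∑ j, w j • N j).PosDef := Matrix.posDef_sum_smul hw hw1 hN
  have hC (j : ι) : (N j ^ (2 - q)).PosDef := (hN j).rpow _
  have hD : (∑ j, w j • N j ^ (2 - q)).PosDef := Matrix.posDef_sum_smul hw hw1 hC
  have hconc : ∑ j, w j • N j ^ (2 - q) ≤ (∑ j, w j • N j) ^ (2 - q) :=
    (CFC.concaveOn_rpow (A := Matrix n n ℂ) (p := 2 - q) ⟨by linarith, by linarith⟩).le_map_sum
      (fun j _ => (hw j).le) hw1 (fun j _ => (hN j).nonneg)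
  have hinv := CStarAlgebra.rpow_neg_one_le_rpow_neg_one hconc hD.isStrictlyPositive
  have key (M : Matrix n n ℂ) (hM : M.PosDef) : M * (M ^ (2 - q)) ^ (-1 : ℝ) * M = M ^ q := by
    have : (M ^ (2 - q)) ^ (-1 : ℝ) = M ^ (q - 2) := by
      refine (eq_comm.1 ?_)
      calc M ^ (q - 2) = (M ^ (2 - q)) ^ (-1 : ℝ) * M ^ (2 - q) * M ^ (q - 2) := by
            rw [(hM.rpow _).rpow_neg_one_mul, one_mul]
        _ = (M ^ (2 - q)) ^ (-1 : ℝ) := by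
            rw [mul_assoc, hM.rpow_mul_rpow, sub_add_sub_cancel, sub_self, hM.rpow_zero_eq, mul_one]
    rw [this]
    nth_rw 1 3 [← hM.rpow_one_eq]
    rw [hM.rpow_mul_rpow, hM.rpow_mul_rpow]
    congr 1
    ring
  calc (∑ j, w j • N j) ^ q
      = (∑ j, w j • N j) * ((∑ j, w j • N j) ^ (2 - q)) ^ (-1 : ℝ) * (∑ j, w j • N j) :=
        (key _ hE).symm
    _ ≤ (∑ j, w j • N j) * (∑ j, w j • N j ^ (2 - q)) ^ (-1 : ℝ) * (∑ j, w j • N j) :=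
        conjugate_le_conjugate_of_nonneg hinv hE.nonneg
    _ ≤ ∑ j, w j • (N j * (N j ^ (2 - q)) ^ (-1 : ℝ) * N j) :=
        Matrix.PosDef.sum_smul_mul_rpow_neg_one_mul_le hw hw1 (fun j => (hN j).1) hC
    _ = ∑ j, w j • N j ^ q := by simp only [key _ (hN _)]

end Sums

/-! ### Bounds by scalar matrices and traces of products -/

lemma Matrix.trace_mul_re_mono {A B N : Matrix n n ℂ} (hAB : A ≤ B) (hN : 0 ≤ N) :
    (A * N).trace.re ≤ (B * N).trace.re := by
  have hs := CFC.sqrt_mul_sqrt_self N hN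
  have h := conjugate_le_conjugate_of_nonneg hAB (CFC.sqrt_nonneg N)
  have h' := (Matrix.le_iff.1 h).trace_nonneg
  rw [Matrix.trace_sub, Matrix.trace_mul_comm, Matrix.trace_mul_comm (_ * A), ← mul_assoc,
    ← mul_assoc, hs, Matrix.trace_mul_comm N, Matrix.trace_mul_comm N] at h'
  have := (Complex.nonneg_iff.1 h').1
  rwa [Complex.sub_re, sub_nonneg] at this

omit [Fintype n] in
lemma Matrix.posDef_of_smul_one_le {A : Matrix n n ℂ} {k : ℝ} (hk : 0 < k) (h : k • 1 ≤ A) :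
    A.PosDef := by
  have := (Matrix.PosDef.one (n := n) (R := ℂ)).smul hk
  simpa using this.add_posSemidef (Matrix.le_iff.1 h)

lemma Matrix.PosDef.exists_smul_one_le {A : Matrix n n ℂ} (hA : A.PosDef) :
    ∃ k : ℝ, 0 < k ∧ k • 1 ≤ A := by
  rcases isEmpty_or_nonempty n with hn | hn
  · exact ⟨1, one_pos, le_of_eq (Subsingleton.elim _ _)⟩
  · obtain ⟨k, hk, h⟩ := (CFC.exists_pos_algebraMap_le_iff (A := Matrix n n ℂ) hA.1).2
      fun x hx => IsStrictlyPositive.spectrum_pos hA.isStrictlyPositive hx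
    exact ⟨k, hk, by rwa [Algebra.algebraMap_eq_smul_one] at h⟩

lemma Matrix.IsHermitian.le_norm_smul_one {A : Matrix n n ℂ} (hA : A.IsHermitian) :
    A ≤ ‖A‖ • 1 := by
  have := IsSelfAdjoint.le_algebraMap_norm_self (a := A) hA
  rwa [Algebra.algebraMap_eq_smul_one] at this

lemma Matrix.smul_one_mono {a b : ℝ} (h : a ≤ b) : a • (1 : Matrix n n ℂ) ≤ b • 1 := by
  rw [← sub_nonneg, ← sub_smul]
  exact smul_nonneg (sub_nonneg.2 h) zero_le_one

lemma Matrix.PosDef.exists_forall_smul_one_le {ι : Type*} [Finite ι] {A : ι → Matrix n n ℂ}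
    (hA : ∀ j, (A j).PosDef) : ∃ k : ℝ, 0 < k ∧ ∀ j, k • 1 ≤ A j := by
  have h (j : ι) : ∀ᶠ k : ℝ in nhdsWithin 0 (Set.Ioi 0), k • 1 ≤ A j := by
    obtain ⟨k, hk, hkA⟩ := (hA j).exists_smul_one_le
    filter_upwards [Ioo_mem_nhdsGT hk] with x hx
    exact (Matrix.smul_one_mono hx.2.le).trans hkA
  obtain ⟨k, hk, hk0⟩ := ((Filter.eventually_all.2 h).and self_mem_nhdsWithin).exists
  exact ⟨k, hk0, hk⟩

lemma Matrix.IsHermitian.exists_forall_le_smul_one {ι : Type*} [Finite ι] {A : ι → Matrix n n ℂ}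
    (hA : ∀ j, (A j).IsHermitian) (c : ℝ) : ∃ k : ℝ, c ≤ k ∧ ∀ j, A j ≤ k • 1 := by
  have h (j : ι) : ∀ᶠ k : ℝ in Filter.atTop, A j ≤ k • 1 := by
    filter_upwards [Filter.eventually_ge_atTop ‖A j‖] with x hx
    exact (hA j).le_norm_smul_one.trans (Matrix.smul_one_mono hx)
  obtain ⟨k, hk, hk0⟩ := ((Filter.eventually_all.2 h).and (Filter.eventually_ge_atTop c)).exists
  exact ⟨k, hk0, hk⟩

lemma Matrix.isCompact_smul_one_Icc (a b : ℝ) :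
    IsCompact (Set.Icc (a • (1 : Matrix n n ℂ)) (b • 1)) := by
  refine Metric.isCompact_of_isClosed_isBounded isClosed_Icc ?_
  refine (Metric.isBounded_iff_subset_closedBall (a • (1 : Matrix n n ℂ))).2
    ⟨‖(b • (1 : Matrix n n ℂ)) - a • 1‖, fun Y hY => ?_⟩
  rw [mem_closedBall_iff_norm]
  exact CStarAlgebra.norm_le_norm_of_nonneg_of_le (sub_nonneg.2 hY.1) (sub_le_sub_right hY.2 _)

/-! ### The objective function and its gradient -/

variable {ι : Type*} [Fintype ι] {w : ι → ℝ} {T : ι → Matrix n n ℂ} {Y Z : Matrix n n ℂ} {z q : ℝ}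

/-- The function `Y ↦ (z / q) tr Y ^ q - ∑ j, w j * tr (T j * Y * T j) ^ z`. For `q = z / α`,
`T j = A j ^ ((1 - α) / (2 * z))` and `Y = X ^ (α / z)` it is, up to a constant, the function of `X`
that the right mean minimizes. -/
noncomputable def meanObjective (z q : ℝ) (w : ι → ℝ) (T : ι → Matrix n n ℂ) (Y : Matrix n n ℂ) : ℝ :=
  z / q * (Y ^ q).trace.re - ∑ j, w j * ((T j * Y * T j) ^ z).trace.re

/-- The gradient of `meanObjective z q w T` at `Y`, divided by `z`. -/
noncomputable def meanGradient (z q : ℝ) (w : ι → ℝ) (T : ι → Matrix n n ℂ) (Y : Matrix n n ℂ) :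
    Matrix n n ℂ :=
  Y ^ (q - 1) - ∑ j, w j • (T j * (T j * Y * T j) ^ (z - 1) * T j)

/-- Convexity of the objective function in gradient form, with the equality case. -/
lemma meanObjective_ge (hw : ∀ j, 0 < w j) (hT : ∀ j, (T j).PosDef) (hz0 : 0 < z) (hz1 : z ≤ 1)
    (hq : 1 ≤ q) (hY : Y.PosDef) (hZ : Z.PosDef) :
    meanObjective z q w T Z + z * (meanGradient z q w T Z * (Y - Z)).trace.re ≤
        meanObjective z q w T Y ∧
      (1 < q ∨ (z < 1 ∧ Nonempty ι) →
        meanObjective z q w T Y ≤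
          meanObjective z q w T Z + z * (meanGradient z q w T Z * (Y - Z)).trace.re → Y = Z) := by
  have hq0 : 0 < q := by linarith
  have h1 := hY.trace_rpow_ge hZ hq
  have h2 (j : ι) := ((hT j).mul_mul_self hY).trace_rpow_le ((hT j).mul_mul_self hZ) hz0 hz1
  have htr (j : ι) : ((T j * Z * T j) ^ (z - 1) * (T j * Y * T j - T j * Z * T j)).trace.re =
      (T j * (T j * Z * T j) ^ (z - 1) * T j * (Y - Z)).trace.re := by
    rw [← sub_mul, ← mul_sub, ← mul_assoc, Matrix.trace_mul_comm]
    simp only [mul_assoc]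
  simp only [htr] at h2
  have hexp : z * (meanGradient z q w T Z * (Y - Z)).trace.re =
      z / q * (q * (Z ^ (q - 1) * (Y - Z)).trace.re) -
        ∑ j, w j * (z * (T j * (T j * Z * T j) ^ (z - 1) * T j * (Y - Z)).trace.re) := by
    rw [meanGradient, sub_mul, Matrix.trace_sub, Complex.sub_re, mul_sub, Finset.sum_mul,
      Matrix.trace_sum, Complex.re_sum, Finset.mul_sum, ← mul_assoc (z / q),
      div_mul_cancel₀ _ hq0.ne']
    congr 1
    refine Finset.sum_congr rfl fun j _ => ?_
    rw [smul_mul_assoc, Matrix.trace_smul, Complex.smul_re, smul_eq_mul]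
    ring
  -- `a` and `b j` are the slacks in Klein's inequality for the individual terms
  set a : ℝ := (Y ^ q).trace.re - ((Z ^ q).trace.re + q * (Z ^ (q - 1) * (Y - Z)).trace.re) with ha
  set b : ι → ℝ := fun j => ((T j * Z * T j) ^ z).trace.re +
    z * (T j * (T j * Z * T j) ^ (z - 1) * T j * (Y - Z)).trace.re -
      ((T j * Y * T j) ^ z).trace.re with hb
  have hdiff : meanObjective z q w T Y -
      (meanObjective z q w T Z + z * (meanGradient z q w T Z * (Y - Z)).trace.re) =
        z / q * a + ∑ j, w j * b j := by
    rw [hexp, meanObjective, meanObjective]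
    simp only [ha, hb, mul_sub, mul_add, Finset.sum_sub_distrib, Finset.sum_add_distrib]
    ring
  have ha0 : 0 ≤ a := sub_nonneg.2 h1.1
  have hb0 (j : ι) : 0 ≤ w j * b j := mul_nonneg (hw j).le (sub_nonneg.2 (h2 j).1)
  have hzq : 0 < z / q := div_pos hz0 hq0
  have hsum : 0 ≤ ∑ j, w j * b j := Finset.sum_nonneg fun j _ => hb0 j
  refine ⟨?_, fun hstrict hle => ?_⟩
  · have := mul_nonneg hzq.le ha0
    linarith
  · have hA : z / q * a = 0 := le_antisymm (by linarith) (mul_nonneg hzq.le ha0)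
    have hB : ∑ j, w j * b j = 0 := le_antisymm (by linarith) hsum
    rcases hstrict with hq' | ⟨hz', ⟨j⟩⟩
    · refine h1.2 hq' ?_
      have := (mul_eq_zero.1 hA).resolve_left hzq.ne'
      linarith
    · rw [Finset.sum_eq_zero_iff_of_nonneg fun j _ => hb0 j] at hB
      have hbj := (mul_eq_zero.1 (hB j (Finset.mem_univ j))).resolve_left (hw j).ne'
      have h := (h2 j).2 hz' (by simp only [hb] at hbj; linarith)
      exact (hT j).isUnit.mul_left_cancel ((hT j).isUnit.mul_right_cancel h)

lemma meanGradient_isHermitian (hT : ∀ j, (T j).PosDef) (hY : Y.PosDef) :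
    (meanGradient z q w T Y).IsHermitian := by
  refine (hY.rpow _).1.sub ?_
  rw [Matrix.IsHermitian, Matrix.conjTranspose_sum]
  refine Finset.sum_congr rfl fun j _ => ?_
  rw [Matrix.conjTranspose_smul, star_trivial,
    ((hT j).mul_mul_self (((hT j).mul_mul_self hY).rpow _)).1.eq]

lemma continuousOn_rpow_posDef (p : ℝ) :
    ContinuousOn (fun A : Matrix n n ℂ => A ^ p) {A | A.PosDef} := by
  have := CFC.continuousOn_rpow (A := Matrix n n ℂ) p
  simpa only [Matrix.isStrictlyPositive_iff_posDef] using this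

omit [Fintype ι] in
lemma continuousOn_mul_mul_rpow (hT : ∀ j, (T j).PosDef) (p : ℝ) (j : ι) :
    ContinuousOn (fun A : Matrix n n ℂ => (T j * A * T j) ^ p) {A | A.PosDef} :=
  (continuousOn_rpow_posDef p).comp (by fun_prop) fun _ hA => (hT j).mul_mul_self hA

omit [DecidableEq n] in
lemma continuous_trace_re : Continuous fun A : Matrix n n ℂ => A.trace.re :=
  Complex.continuous_re.comp (Continuous.matrix_trace continuous_id)

lemma continuousOn_meanObjective (hT : ∀ j, (T j).PosDef) :
    ContinuousOn (meanObjective z q w T) {A | A.PosDef} := by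
  refine ContinuousOn.sub (continuousOn_const.mul
    (continuous_trace_re.comp_continuousOn (continuousOn_rpow_posDef q))) ?_
  exact continuousOn_finsetSum _ fun j _ => continuousOn_const.mul
    (continuous_trace_re.comp_continuousOn (continuousOn_mul_mul_rpow hT z j))

lemma continuousOn_meanGradient (hT : ∀ j, (T j).PosDef) :
    ContinuousOn (meanGradient z q w T) {A | A.PosDef} := by
  refine ContinuousOn.sub (continuousOn_rpow_posDef _) ?_
  exact continuousOn_finsetSum _ fun j _ => ContinuousOn.const_smul
    ((continuousOn_const.mul (continuousOn_mul_mul_rpow hT (z - 1) j)).mul continuousOn_const) (w j)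

/-- Stationarity of a minimizer. Differentiability of the objective function is not needed: convexity
at `Y + t • H` gives `0 ≤ tr (∇(Y + t • H) H)` for small `t > 0`, and the gradient is continuous. -/
lemma meanGradient_eq_zero (hw : ∀ j, 0 < w j) (hT : ∀ j, (T j).PosDef) (hz0 : 0 < z) (hz1 : z ≤ 1)
    (hq : 1 ≤ q) (hY : Y.PosDef)
    (hmin : ∀ Z : Matrix n n ℂ, Z.PosDef → meanObjective z q w T Y ≤ meanObjective z q w T Z) :
    meanGradient z q w T Y = 0 := by
  set H := -meanGradient z q w T Y with hH
  have hHh : H.IsHermitian := (meanGradient_isHermitian hT hY).neg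
  obtain ⟨k, hk, hkY⟩ := hY.exists_smul_one_le
  -- `H ≥ -‖H‖`, so `Y + t • H ≥ k - t * ‖H‖` is positive definite for small `t`
  have hpd : ∀ᶠ t : ℝ in nhdsWithin 0 (Set.Ioi 0), (Y + t • H).PosDef := by
    have hlim : Filter.Tendsto (fun t : ℝ => k - t * ‖H‖) (nhdsWithin 0 (Set.Ioi 0)) (nhds k) := by
      have : Continuous fun t : ℝ => k - t * ‖H‖ := by fun_prop
      simpa using (this.tendsto 0).mono_left nhdsWithin_le_nhds
    filter_upwards [hlim.eventually (lt_mem_nhds hk), self_mem_nhdsWithin] with t ht ht0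
    refine Matrix.posDef_of_smul_one_le ht ?_
    have h1 := smul_le_smul_of_nonneg_left hHh.neg.le_norm_smul_one (Set.mem_Ioi.1 ht0).le
    rw [norm_neg, smul_neg, smul_smul] at h1
    have h2 := add_le_add hkY (neg_le_neg h1)
    rwa [neg_neg, ← sub_eq_add_neg, ← sub_smul] at h2
  have hnn : ∀ᶠ t : ℝ in nhdsWithin 0 (Set.Ioi 0),
      0 ≤ (meanGradient z q w T (Y + t • H) * H).trace.re := by
    filter_upwards [hpd, self_mem_nhdsWithin] with t ht ht0
    have h1 := (meanObjective_ge hw hT hz0 hz1 hq hY ht).1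
    have h2 := hmin _ ht
    rw [sub_add_cancel_left, mul_neg, Matrix.trace_neg, Complex.neg_re, mul_smul_comm,
      Matrix.trace_smul, Complex.smul_re, smul_eq_mul] at h1
    have h3 : 0 ≤ z * (t * (meanGradient z q w T (Y + t • H) * H).trace.re) := by linarith
    exact nonneg_of_mul_nonneg_right (nonneg_of_mul_nonneg_right h3 hz0) ht0
  have hlim : Filter.Tendsto (fun t : ℝ => (meanGradient z q w T (Y + t • H) * H).trace.re)
      (nhdsWithin 0 (Set.Ioi 0)) (nhds (meanGradient z q w T Y * H).trace.re) := by
    have hc : Filter.Tendsto (fun t : ℝ => Y + t • H) (nhdsWithin 0 (Set.Ioi 0))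
        (nhdsWithin Y {A | A.PosDef}) := by
      refine tendsto_nhdsWithin_iff.2 ⟨?_, hpd⟩
      have : Continuous fun t : ℝ => Y + t • H := by fun_prop
      simpa using (this.tendsto 0).mono_left nhdsWithin_le_nhds
    exact (continuous_trace_re.tendsto _).comp
      (((continuousOn_meanGradient hT Y hY).tendsto.comp hc).mul_const H)
  have h0 := ge_of_tendsto hlim hnn
  have hsq := (Matrix.posSemidef_conjTranspose_mul_self (meanGradient z q w T Y)).trace_nonneg
  rw [hH, mul_neg, Matrix.trace_neg, Complex.neg_re] at h0
  refine Matrix.trace_conjTranspose_mul_self_eq_zero_iff.1 (Complex.ext ?_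
    (Complex.nonneg_iff.1 hsq).2.symm)
  have := (Complex.nonneg_iff.1 hsq).1
  rw [(meanGradient_isHermitian hT hY).eq] at this ⊢
  rw [Complex.zero_re]
  linarith

/-! ### Existence of a minimizer -/

/-- Scalar bounds on the `T j * T j` enclose the gradient between functions of `Y`. -/
lemma meanGradient_bounds (hw : ∀ j, 0 < w j) (hw1 : ∑ j, w j = 1) (hT : ∀ j, (T j).PosDef)
    (hz : z ∈ Set.Icc (0 : ℝ) 1) (hY : Y.PosDef) {k k' : ℝ} (hk : 0 < k) (hk' : 0 < k')
    (hkT : ∀ j, k • 1 ≤ T j * T j) (hkT' : ∀ j, T j * T j ≤ k' • 1) :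
    Y ^ (q - 1) - k' ^ z • Y ^ (z - 1) ≤ meanGradient z q w T Y ∧
      meanGradient z q w T Y ≤ Y ^ (q - 1) - k ^ z • Y ^ (z - 1) := by
  have hc (c : Matrix n n ℂ) : c = ∑ j, w j • c := by rw [← Finset.sum_smul, hw1, one_smul]
  constructor
  · refine sub_le_sub_left ?_ _
    rw [hc (k' ^ z • Y ^ (z - 1))]
    exact Finset.sum_le_sum fun j _ => smul_le_smul_of_nonneg_left
      ((hT j).mul_rpow_sub_one_mul_le hY hz hk' (hkT' j)) (hw j).le
  · refine sub_le_sub_left ?_ _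
    rw [hc (k ^ z • Y ^ (z - 1))]
    exact Finset.sum_le_sum fun j _ => smul_le_smul_of_nonneg_left
      ((hT j).le_mul_rpow_sub_one_mul hY hz hk (hkT j)) (hw j).le

/-- Truncating the eigenvalues of `Y` to `[a, b]` does not increase the objective function. The
hypotheses make the scalar bounds on the gradient vanish at the eigenvalues `a` and `b` of the
truncation `Z`, so that `tr (∇(Z) (Y - Z)) ≥ 0`. -/
lemma exists_mem_Icc_meanObjective_le (hw : ∀ j, 0 < w j) (hw1 : ∑ j, w j = 1)
    (hT : ∀ j, (T j).PosDef) (hz0 : 0 < z) (hz1 : z ≤ 1) (hq : 1 ≤ q) (hY : Y.PosDef) {a b : ℝ}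
    (ha : 0 < a) (hab : a ≤ b)
    (haT : ∀ j, a ^ ((q - z) / z) • 1 ≤ T j * T j) (hbT : ∀ j, T j * T j ≤ b ^ ((q - z) / z) • 1) :
    ∃ Z ∈ Set.Icc (a • (1 : Matrix n n ℂ)) (b • 1),
      meanObjective z q w T Z ≤ meanObjective z q w T Y := by
  have hb : 0 < b := ha.trans_le hab
  have hfin (f : ℝ → ℝ) : ContinuousOn f (spectrum ℝ Y) :=
    (Matrix.finite_real_spectrum).continuousOn f
  set c : ℝ → ℝ := fun y => max a (min b y) with hc
  have hca (y : ℝ) : a ≤ c y := le_max_left _ _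
  have hcb (y : ℝ) : c y ≤ b := max_le hab (min_le_left _ _)
  have hZa : a • (1 : Matrix n n ℂ) ≤ cfc c Y := by
    rw [← Algebra.algebraMap_eq_smul_one]
    exact algebraMap_le_cfc c a Y (fun x _ => hca x) (hfin _) hY.1
  have hZb : cfc c Y ≤ b • (1 : Matrix n n ℂ) := by
    rw [← Algebra.algebraMap_eq_smul_one]
    exact cfc_le_algebraMap c b Y (fun x _ => hcb x) (hfin _) hY.1
  have hZ : (cfc c Y).PosDef := Matrix.posDef_of_smul_one_le ha hZa
  refine ⟨cfc c Y, ⟨hZa, hZb⟩, ?_⟩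
  have hpow (p : ℝ) : cfc c Y ^ p = cfc (fun y => c y ^ p) Y :=
    CFC.cfc_rpow (fun x _ => ha.trans_le (hca x)) (hfin _) hY.1
  have hscal {d : ℝ} (hd : 0 < d) : (d ^ ((q - z) / z)) ^ z * d ^ (z - 1) = d ^ (q - 1) := by
    rw [← Real.rpow_mul hd.le, div_mul_cancel₀ _ hz0.ne', ← Real.rpow_add hd]
    congr 1
    ring
  have hcomb (d : ℝ) (g : ℝ → ℝ) : (cfc c Y ^ (q - 1) - d • cfc c Y ^ (z - 1)) * cfc g Y =
      cfc (fun y => (c y ^ (q - 1) - d * c y ^ (z - 1)) * g y) Y := by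
    rw [hpow, hpow, ← cfc_const_mul d _ Y (hfin _), ← cfc_sub _ _ Y (hfin _) (hfin _),
      ← cfc_mul _ _ Y (hfin _) (hfin _)]
  have hbd := meanGradient_bounds (q := q) hw hw1 hT ⟨hz0.le, hz1⟩ hZ
    (Real.rpow_pos_of_pos ha _) (Real.rpow_pos_of_pos hb _) haT hbT
  -- the parts of `Y - Z` above `b` and below `a`
  have hplus : 0 ≤ (meanGradient z q w T (cfc c Y) * cfc (fun y => max (y - b) 0) Y).trace.re := by
    have hN : 0 ≤ cfc (fun y : ℝ => max (y - b) 0) Y := cfc_nonneg fun x _ => le_max_right _ _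
    refine le_trans (le_of_eq ?_) (Matrix.trace_mul_re_mono hbd.1 hN)
    rw [hcomb, cfc_congr (g := fun _ => (0 : ℝ)) fun y _ => ?_, cfc_const_zero, Matrix.trace_zero,
      Complex.zero_re]
    rcases le_total y b with h | h
    · simp [h]
    · have : c y = b := by rw [hc]; simp [h, hab]
      simp only [this, hscal hb, sub_self, zero_mul]
  have hminus : (meanGradient z q w T (cfc c Y) * cfc (fun y => max (a - y) 0) Y).trace.re ≤ 0 := by
    have hN : 0 ≤ cfc (fun y : ℝ => max (a - y) 0) Y := cfc_nonneg fun x _ => le_max_right _ _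
    refine le_trans (Matrix.trace_mul_re_mono hbd.2 hN) (le_of_eq ?_)
    rw [hcomb, cfc_congr (g := fun _ => (0 : ℝ)) fun y _ => ?_, cfc_const_zero, Matrix.trace_zero,
      Complex.zero_re]
    rcases le_total a y with h | h
    · simp [h]
    · have : c y = a := by rw [hc]; simp [h]
      simp only [this, hscal ha, sub_self, zero_mul]
  have hdiff : Y - cfc c Y =
      cfc (fun y : ℝ => max (y - b) 0) Y - cfc (fun y : ℝ => max (a - y) 0) Y := by
    have hYs : IsSelfAdjoint Y := hY.1
    nth_rw 1 [← cfc_id' ℝ Y hYs]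
    rw [← cfc_sub _ _ Y (hfin _) (hfin _), ← cfc_sub _ _ Y (hfin _) (hfin _)]
    refine cfc_congr fun y _ => ?_
    simp only [hc]
    rcases le_total y b with h | h <;> rcases le_total a y with h' | h' <;>
      simp [h, h', hab]
    linarith
  have h := (meanObjective_ge hw hT hz0 hz1 hq hY hZ).1
  rw [hdiff, mul_sub, Matrix.trace_sub, Complex.sub_re] at h
  have := mul_nonneg hz0.le (sub_nonneg.2 (hminus.trans hplus))
  linarith

lemma exists_meanObjective_minimizer (hw : ∀ j, 0 < w j) (hw1 : ∑ j, w j = 1)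
    (hT : ∀ j, (T j).PosDef) (hz0 : 0 < z) (hz1 : z ≤ 1) (hq : 1 ≤ q) (hzq : z < q) :
    ∃ Y : Matrix n n ℂ, Y.PosDef ∧
      ∀ Z : Matrix n n ℂ, Z.PosDef → meanObjective z q w T Y ≤ meanObjective z q w T Z := by
  have hK (j : ι) : (T j * T j).PosDef := by
    have := (hT j).mul_mul_self Matrix.PosDef.one
    rwa [mul_one] at this
  obtain ⟨k, hk, hkT⟩ := Matrix.PosDef.exists_forall_smul_one_le hK
  obtain ⟨k', hkk', hkT'⟩ := Matrix.IsHermitian.exists_forall_le_smul_one (fun j => (hK j).1) k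
  have hk' : 0 < k' := hk.trans_le hkk'
  have he : 0 < z / (q - z) := div_pos hz0 (sub_pos.2 hzq)
  have hroot {d : ℝ} (hd : 0 < d) : (d ^ (z / (q - z))) ^ ((q - z) / z) = d := by
    rw [← Real.rpow_mul hd.le, div_mul_div_cancel₀ (sub_pos.2 hzq).ne', div_self hz0.ne',
      Real.rpow_one]
  set a := k ^ (z / (q - z)) with ha
  set b := k' ^ (z / (q - z)) with hb
  have ha0 : 0 < a := Real.rpow_pos_of_pos hk _
  have hab : a ≤ b := Real.rpow_le_rpow hk.le hkk' he.le
  obtain ⟨Y, hYab, hY⟩ := (Matrix.isCompact_smul_one_Icc (n := n) a b).exists_isMinOn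
    ⟨a • 1, le_rfl, Matrix.smul_one_mono hab⟩
    ((continuousOn_meanObjective (z := z) (q := q) (w := w) hT).mono
      fun Z hZ => Matrix.posDef_of_smul_one_le ha0 hZ.1)
  refine ⟨Y, Matrix.posDef_of_smul_one_le ha0 hYab.1, fun Z hZ => ?_⟩
  obtain ⟨Z', hZ', hle⟩ := exists_mem_Icc_meanObjective_le hw hw1 hT hz0 hz1 hq hZ ha0 hab
    (by rwa [ha, hroot hk]) (by rwa [hb, hroot hk'])
  exact (isMinOn_iff.1 hY Z' hZ').trans hle

/-! ### The bound for critical points -/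

/-- At a critical point, `Y ^ q = ∑ j, w j • N j ^ z` with
`N j = Y ^ (1 / 2) * (T j * T j) * Y ^ (1 / 2)`; since `1 ≤ 1 / z ≤ 2`, the operator Jensen
inequality bounds `Y ^ (q / z)` by `∑ j, w j • N j`. -/
lemma rpow_le_sum_of_meanGradient_eq_zero (hw : ∀ j, 0 < w j) (hw1 : ∑ j, w j = 1)
    (hT : ∀ j, (T j).PosDef) (hz : 1 / 2 ≤ z) (hz1 : z ≤ 1) (hq : 1 ≤ q) (hY : Y.PosDef)
    (h : meanGradient z q w T Y = 0) : Y ^ (q / z - 1) ≤ ∑ j, w j • (T j * T j) := by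
  have hz0 : 0 < z := by linarith
  set N : ι → Matrix n n ℂ := fun j => Y ^ (1 / 2 : ℝ) * (T j * T j) * Y ^ (1 / 2 : ℝ) with hNdef
  have hN (j : ι) : (N j).PosDef := by
    refine (hY.rpow _).mul_mul_self ?_
    have := (hT j).mul_mul_self Matrix.PosDef.one
    rwa [mul_one] at this
  have pull (P : Matrix n n ℂ) (X : ι → Matrix n n ℂ) :
      ∑ j, w j • (P * X j * P) = P * (∑ j, w j • X j) * P := by
    simp only [Finset.mul_sum, Finset.sum_mul, mul_smul_comm, smul_mul_assoc]
  have hsum : Y ^ q = ∑ j, w j • N j ^ z := by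
    have h1 : Y ^ (q - 1) = Y ^ (-(1 / 2) : ℝ) * (∑ j, w j • N j ^ z) * Y ^ (-(1 / 2) : ℝ) := by
      rw [← pull, sub_eq_zero.1 h]
      exact Finset.sum_congr rfl fun j _ => by rw [(hT j).mul_rpow_sub_one_mul hY]
    calc Y ^ q = Y ^ (1 / 2 : ℝ) * Y ^ (q - 1) * Y ^ (1 / 2 : ℝ) := by
          rw [hY.rpow_mul_rpow, hY.rpow_mul_rpow]
          congr 1
          ring
      _ = (Y ^ (1 / 2 : ℝ) * Y ^ (-(1 / 2) : ℝ)) * (∑ j, w j • N j ^ z) *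
            (Y ^ (-(1 / 2) : ℝ) * Y ^ (1 / 2 : ℝ)) := by
          rw [h1]
          simp only [mul_assoc]
      _ = ∑ j, w j • N j ^ z := by
          rw [hY.half_mul_neg_half, hY.neg_half_mul_half, one_mul, mul_one]
  have hconv := Matrix.PosDef.sum_smul_rpow_le hw hw1 (fun j => (hN j).rpow z) (q := 1 / z)
    ((one_le_div hz0).2 hz1) ((div_le_iff₀ hz0).2 (by linarith))
  rw [← hsum, CFC.rpow_rpow Y q (1 / z) (by linarith) hY.isStrictlyPositive, mul_one_div] at hconv
  have hr (j : ι) : (N j ^ z) ^ (1 / z) = N j := by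
    rw [CFC.rpow_rpow (N j) z (1 / z) hz0.ne' (hN j).isStrictlyPositive, mul_one_div_cancel hz0.ne',
      (hN j).rpow_one_eq]
  simp only [hr] at hconv
  rw [hNdef, pull] at hconv
  have h2 := conjugate_le_conjugate_of_nonneg hconv (hY.rpow (-(1 / 2))).nonneg
  rw [hY.neg_half_mul_rpow_mul_neg_half] at h2
  refine h2.trans (le_of_eq ?_)
  calc _ = (Y ^ (-(1 / 2) : ℝ) * Y ^ (1 / 2 : ℝ)) * (∑ j, w j • (T j * T j)) *
            (Y ^ (1 / 2 : ℝ) * Y ^ (-(1 / 2) : ℝ)) := by simp only [mul_assoc]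
    _ = _ := by rw [hY.half_mul_neg_half, hY.neg_half_mul_half, one_mul, mul_one]

end

/-! ### The right mean -/

/-- The objective of the right mean in the variable `X ^ (α / z)`. -/
lemma sum_bwDivergence {m n : ℕ} {α z : ℝ} (hα : 0 < α) (hz : 0 < z) {w : Fin n → ℝ}
    (hw1 : ∑ j, w j = 1) (A : Fin n → Matrix (Fin m) (Fin m) ℂ)
    {X : Matrix (Fin m) (Fin m) ℂ} (hX : X.PosDef) :
    ∑ j, w j * bwDivergence α z (A j) X = ∑ j, w j * ((1 - α) * (A j).trace.re) +
      meanObjective z (z / α) w (fun j => A j ^ ((1 - α) / (2 * z))) (X ^ (α / z)) := by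
  have hXq : (X ^ (α / z)) ^ (z / α) = X := by
    rw [CFC.rpow_rpow X _ _ (div_pos hα hz).ne' hX.isStrictlyPositive, div_mul_div_cancel₀ hz.ne',
      div_self hα.ne', hX.rpow_one_eq]
  rw [meanObjective, hXq, div_div_cancel₀ hz.ne']
  have hX1 : α * X.trace.re = ∑ j, w j * (α * X.trace.re) := by
    rw [← Finset.sum_mul, hw1, one_mul]
  rw [hX1, ← Finset.sum_sub_distrib, ← Finset.sum_add_distrib]
  refine Finset.sum_congr rfl fun j _ => ?_
  simp only [bwDivergence, renyiQ, Matrix.trace_add, Matrix.trace_smul, Complex.sub_re,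
    Complex.add_re, Complex.smul_re, smul_eq_mul]
  ring

lemma isRightMean_iff {m n : ℕ} {α z : ℝ} (hα : 0 < α) (hz : 0 < z) {w : Fin n → ℝ}
    (hw1 : ∑ j, w j = 1) (A : Fin n → Matrix (Fin m) (Fin m) ℂ) {X : Matrix (Fin m) (Fin m) ℂ}
    (hX : X.PosDef) :
    IsRightMean α z w A X ↔ ∀ Y : Matrix (Fin m) (Fin m) ℂ, Y.PosDef →
      meanObjective z (z / α) w (fun j => A j ^ ((1 - α) / (2 * z))) (X ^ (α / z)) ≤
        meanObjective z (z / α) w (fun j => A j ^ ((1 - α) / (2 * z))) Y := by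
  refine ⟨fun h Y hY => ?_, fun h => ⟨hX, fun Y hY => ?_⟩⟩
  · have h1 := h.2 (Y ^ (z / α)) (hY.rpow _)
    rw [sum_bwDivergence hα hz hw1 A hX, sum_bwDivergence hα hz hw1 A (hY.rpow _),
      CFC.rpow_rpow Y _ _ (div_pos hz hα).ne' hY.isStrictlyPositive, div_mul_div_cancel₀ hα.ne',
      div_self hz.ne', hY.rpow_one_eq] at h1
    linarith
  · rw [sum_bwDivergence hα hz hw1 A hX, sum_bwDivergence hα hz hw1 A hY]
    linarith [h (Y ^ (α / z)) (hY.rpow _)]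

theorem theoremT {m n : ℕ} (α z : ℝ) (hα : 0 < α) (hαz : α ≤ z) (hz : 1 / 2 ≤ z) (hz1 : z ≤ 1)
    (w : Fin n → ℝ) (hw : ∀ j, 0 < w j) (hw1 : ∑ j, w j = 1)
    (A : Fin n → Matrix (Fin m) (Fin m) ℂ) (hA : ∀ j, (A j).PosDef) :
    (α < 1 → ∃! X : Matrix (Fin m) (Fin m) ℂ, IsRightMean α z w A X) ∧
      ∀ X : Matrix (Fin m) (Fin m) ℂ, IsRightMean α z w A X →
        X ^ ((1 - α) / z) ≤ ∑ j, w j • (A j) ^ ((1 - α) / z) := by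
  have hz0 : 0 < z := hα.trans_le hαz
  have hq : 1 ≤ z / α := (one_le_div hα).2 hαz
  have hT (j : Fin n) : (A j ^ ((1 - α) / (2 * z))).PosDef := (hA j).rpow _
  have hcrit (X : Matrix (Fin m) (Fin m) ℂ) (hX : IsRightMean α z w A X) :
      meanGradient z (z / α) w (fun j => A j ^ ((1 - α) / (2 * z))) (X ^ (α / z)) = 0 :=
    meanGradient_eq_zero hw hT hz0 hz1 hq (hX.1.rpow _) ((isRightMean_iff hα hz0 hw1 A hX.1).1 hX)
  have hinv (X : Matrix (Fin m) (Fin m) ℂ) (hX : X.PosDef) : (X ^ (α / z)) ^ (z / α) = X := by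
    rw [CFC.rpow_rpow X _ _ (div_pos hα hz0).ne' hX.isStrictlyPositive,
      div_mul_div_cancel₀ hz0.ne', div_self hα.ne', hX.rpow_one_eq]
  refine ⟨fun hα1 => ?_, fun X hX => ?_⟩
  · have hzq : z < z / α := by
      rw [lt_div_iff₀ hα]
      exact mul_lt_of_lt_one_right hz0 hα1
    obtain ⟨Y, hY, hmin⟩ := exists_meanObjective_minimizer hw hw1 hT hz0 hz1 hq hzq
    have hYX : (Y ^ (z / α)) ^ (α / z) = Y := by
      rw [CFC.rpow_rpow Y _ _ (div_pos hz0 hα).ne' hY.isStrictlyPositive,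
        div_mul_div_cancel₀ hα.ne', div_self hz0.ne', hY.rpow_one_eq]
    refine ⟨Y ^ (z / α), (isRightMean_iff hα hz0 hw1 A (hY.rpow _)).2 (by rwa [hYX]),
      fun X hX => ?_⟩
    -- `z = 1` and `z / α = 1` cannot both hold, as `α < 1`
    have hstrict : 1 < z / α ∨ (z < 1 ∧ Nonempty (Fin n)) := by
      rcases hz1.lt_or_eq with h | h
      · refine Or.inr ⟨h, ?_⟩
        by_contra hne
        rw [not_nonempty_iff] at hne
        simp at hw1
      · exact Or.inl (h ▸ hzq)
    have heq := (meanObjective_ge hw hT hz0 hz1 hq hY (hX.1.rpow (α / z))).2 hstrict (by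
      rw [hcrit X hX, zero_mul, Matrix.trace_zero, Complex.zero_re, mul_zero, add_zero]
      exact hmin _ (hX.1.rpow _))
    rw [heq, hinv X hX.1]
  · have h := rpow_le_sum_of_meanGradient_eq_zero hw hw1 hT hz hz1 hq (hX.1.rpow (α / z))
      (hcrit X hX)
    have e1 : (X ^ (α / z)) ^ (z / α / z - 1) = X ^ ((1 - α) / z) := by
      rw [CFC.rpow_rpow X _ _ (div_pos hα hz0).ne' hX.1.isStrictlyPositive]
      congr 1
      field_simp
    have e2 (j : Fin n) : A j ^ ((1 - α) / (2 * z)) * A j ^ ((1 - α) / (2 * z)) =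
        A j ^ ((1 - α) / z) := by
      rw [(hA j).rpow_mul_rpow]
      congr 1
      field_simp
      ring
    simpa only [e1, e2] using h
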